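/- Let $N\ge 0$, let $a=[\alpha_1,\dots,\alpha_{N+1}]$ be a list of positive integers, and for $t\in\mathbb Z_{\ge 0}$ let $E(a)(t)$ be the number of solutions $(x_1,\dots,x_{N+1})$ in non-negative integers of $\alpha_1x_1+\dots+\alpha_{N+1}x_{N+1}=t$. There are unique periodic functions $E_0,\dots,E_N:\mathbb Z_{\ge 0}\to\mathbb Q$ with $E(a)(t)=\sum_{k=0}^{N}E_k(t)\,t^k$ for all $t\ge 0$. Let $\ell$ be the largest size of a sublist of $a$ whose greatest common divisor is not $1$ (with $\ell=0$ if all $\alpha_i=1$). Then: (1) for every $k$ with $\ell\le k\le N$, the coefficient $E_k$ is constant; (2) if $\ell\ge 1$, the coefficient $E_{\ell-1}$ of degree $\ell-1$ is not constant. Moreover, if $\mathcal G$ is the set of the greatest common divisors of the sublists of $a$ of size at least $\ell$, then the elements of $\mathcal G$ are pairwise coprime, and the minimal period of $E_{\ell-1}$ is $\prod_{f\in\mathcal G}f=\prod_{f\in\mathcal G,\,f\ne 1}f$; (3) if the numbers $\alpha_i$ are given by their prime factorizations (for each $\alpha_i$, the list of its distinct prime divisors with their exponents, all written in binary), then $\ell$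 can be computed in time polynomial in the size of this input. -/

import Mathlib

namespace Denumerant

/-- The denumerant `E(a)(t)`: the number of solutions in non-negative integers `x` of
`∑ i, a i * x i = t`. -/
noncomputable def denumerant {n : ℕ} (a : Fin n → ℕ) (t : ℕ) : ℕ :=
  Set.ncard {x : Fin n → ℕ | ∑ i, a i * x i = t}

/-- `E 0, …, E N` are the coefficients of the quasi-polynomial `E(a)(t)`, for a list `a` of length
`N + 1`: each `E k` is a periodic function of `t`, and `E(a)(t) = ∑ k, E k t * t ^ k` for every
non-negative integer `t`. -/
def IsCoefficients {N : ℕ} (a : Fin (N + 1) → ℕ) (E : Fin (N + 1) → ℕ → ℚ) : Prop :=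
  (∀ k, ∃ q : ℕ, 0 < q ∧ Function.Periodic (E k) q) ∧
    ∀ t : ℕ, (denumerant a t : ℚ) = ∑ k : Fin (N + 1), E k t * (t : ℚ) ^ (k : ℕ)

/-- The set of the greatest common divisors of the sublists of `a` of size greater than `m`. -/
def gcdSet {n : ℕ} (m : ℕ) (a : Fin n → ℕ) : Finset ℕ :=
  (Finset.univ.filter fun J : Finset (Fin n) => m < J.card).image fun J => J.gcd a

/-- The largest size of a sublist of `a` whose greatest common divisor is not `1`. The empty
sublist has greatest common divisor `0`, so that the value is `0` when all the `a i` are `1`. -/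
def maxSize {n : ℕ} (a : Fin n → ℕ) : ℕ :=
  (Finset.univ.filter fun J : Finset (Fin n) => J.gcd a ≠ 1).sup Finset.card

/-- A positive integer given by its prime factorization `p₁ ^ e₁ * ⋯ * pᵣ ^ eᵣ`: the list of the
pairs `(pⱼ, eⱼ)`, with distinct primes `pⱼ` (in any order) and exponents `eⱼ ≥ 1`. -/
structure FactoredNat where
  factors : List (ℕ × ℕ)
  prime : ∀ pe ∈ factors, pe.1.Prime
  pos : ∀ pe ∈ factors, 0 < pe.2
  nodup : (factors.map Prod.fst).Nodup

/-- The integer with the given prime factorization. -/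
def FactoredNat.value (x : FactoredNat) : ℕ :=
  (x.factors.map fun pe => pe.1 ^ pe.2).prod

/-- The input alphabet: the two binary digits and three punctuation marks. -/
inductive Symbol where
  | zero
  | one
  | pow
  | times
  | comma

/-- A natural number in binary (least significant digit first, no leading zeros). -/
def encodeNumber (n : ℕ) : List Symbol :=
  (Computability.encodeNat n).map fun b => cond b Symbol.one Symbol.zero

/-- A factored number is written as `p₁ pow e₁ times ⋯ pᵣ pow eᵣ times comma`, with primes and
exponents in binary. -/
def encodeFactored (x : FactoredNat) : List Symbol :=
  (x.factors.flatMap fun pe =>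
    encodeNumber pe.1 ++ [Symbol.pow] ++ encodeNumber pe.2 ++ [Symbol.times]) ++ [Symbol.comma]

/-- A list of factored numbers is written by writing its entries one after the other. -/
def encodeInput (L : List FactoredNat) : List Symbol :=
  L.flatMap encodeFactored

/-- The number `maxSize` of the list of integers whose prime factorizations are given. -/
def maxSizeFactored (L : List FactoredNat) : ℕ :=
  maxSize fun i : Fin L.length => (L.get i).value

end Denumerant

/-! The generating function of the denumerant is `∏ 1 / (1 - X ^ a i)`. Its poles are roots of
unity, and the order of the pole `ξ` is `rootMult a ξ`, the number of `i` with `ξ ^ a i = 1`.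
Partial fractions (`exists_denumerant_eq_sum`) write `E(a)(t)` as a sum of terms `c ξ d * (t +
d).choose d * ξ⁻¹ ^ t` with `d < rootMult a ξ`, where the top coefficient at each pole is nonzero.
Collecting powers of `t` gives the `E k`.

If `ξ ≠ 1`, its order divides every entry counted by `rootMult a ξ`, so these entries have gcd
different from `1` and `rootMult a ξ ≤ ℓ`. In degree `k ≥ ℓ` only `ξ = 1` survives and `E k` is
constant. In degree `ℓ - 1` the surviving `ξ ≠ 1` are those of multiplicity exactly `ℓ`, each with
nonzero coefficient. By linear independence of the functions `t ↦ ξ⁻¹ ^ t`, `q` is a period iff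
every gcd in `gcdSet` divides `q` (`periodic_coefficient_iff`). These gcds are pairwise coprime, so
the least period is their product.

For the algorithm, a gcd differs from `1` iff some prime divides it, so `ℓ` is the largest
multiplicity in the concatenated list of prime divisors (`maxCount_wordsOf`). An explicit stack
machine finds it by comparing all pairs of primes, in cubic time (`Machine.reach_halt`). -/

namespace Denumerant

section

open Finset

/-! ### Generating function and partial fractions -/

/-- The generating function of the multiples of `m`. -/
noncomputable def multiplesSeries (m : ℕ) : PowerSeries ℂ :=
  PowerSeries.mk fun n => if m ∣ n then 1 else 0

theorem multiplesSeries_mul {m : ℕ} (hm : 0 < m) :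
    multiplesSeries m * (PowerSeries.X ^ m - 1) = -1 := by
  ext n
  rw [mul_sub, map_sub, mul_one, PowerSeries.coeff_mul_X_pow', map_neg, PowerSeries.coeff_one]
  simp only [multiplesSeries, PowerSeries.coeff_mk]
  rcases eq_or_ne n 0 with rfl | hn
  · simp [hm.ne']
  · by_cases h : m ≤ n
    · simp [h, hn, Nat.dvd_sub_self_right]
      by_cases h' : m ∣ n
      · simp [h']
      · have : n ≠ m := fun h => h' (h ▸ dvd_rfl)
        have : ¬ n ≤ m := by omega
        simp [h', this]
    · have : ¬ m ∣ n := fun h' => h (Nat.le_of_dvd (Nat.pos_of_ne_zero hn) h')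
      simp [h, hn, this]

/-- The map `x ↦ (a i * x i)` identifies solutions with families of multiples of the `a i` summing
to `t`. -/
theorem denumerant_eq_coeff {n : ℕ} (a : Fin n → ℕ) (ha : ∀ i, 0 < a i) (t : ℕ) :
    (denumerant a t : ℂ) = PowerSeries.coeff t (∏ i, multiplesSeries (a i)) := by
  classical
  rw [PowerSeries.coeff_prod]
  trans ((#{l ∈ finsuppAntidiag univ t | ∀ i, a i ∣ l i} : ℕ) : ℂ)
  swap
  · simp [multiplesSeries, prod_boole]
  congr 1
  rw [denumerant, ← Set.ncard_coe_finset]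
  refine Set.ncard_congr (fun x _ => Finsupp.equivFunOnFinite.symm fun i => a i * x i) ?_ ?_ ?_
  · intro x hx
    simpa [mem_finsuppAntidiag] using hx
  · intro x y _ _ h
    have h' := Finsupp.equivFunOnFinite.symm.injective h
    funext i
    exact Nat.eq_of_mul_eq_mul_left (ha i) (congrFun h' i)
  · intro l hl
    simp only [coe_filter, mem_finsuppAntidiag, Set.mem_ofPred_eq] at hl
    choose x hx using hl.2
    refine ⟨x, ?_, ?_⟩
    · rw [Set.mem_ofPred_eq, ← hl.1.1]
      exact sum_congr rfl fun i _ => (hx i).symm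
    · ext i
      simp [hx i]

/-- The inverse of `X - ξ` in the ring of power series. -/
noncomputable def invXSub (ξ : ℂ) : PowerSeries ℂ :=
  PowerSeries.C (-ξ⁻¹) * PowerSeries.rescale ξ⁻¹ (PowerSeries.mk 1)

theorem invXSub_mul {ξ : ℂ} (hξ : ξ ≠ 0) :
    invXSub ξ * (PowerSeries.X - PowerSeries.C ξ) = 1 := by
  have h := congrArg (PowerSeries.rescale ξ⁻¹) (PowerSeries.mk_one_mul_one_sub_eq_one ℂ)
  rw [map_mul, map_sub, map_one, PowerSeries.rescale_X] at h
  have h2 : PowerSeries.C (R := ℂ) ξ⁻¹ * PowerSeries.C ξ = 1 := by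
    rw [← map_mul, inv_mul_cancel₀ hξ, map_one]
  rw [invXSub, map_neg]
  linear_combination h + PowerSeries.rescale ξ⁻¹ (PowerSeries.mk 1) * h2

theorem coeff_invXSub_pow (ξ : ℂ) (d t : ℕ) :
    PowerSeries.coeff t (invXSub ξ ^ (d + 1)) =
      (-ξ⁻¹) ^ (d + 1) * ((t + d).choose d * ξ⁻¹ ^ t) := by
  rw [invXSub, mul_pow, ← map_pow, ← map_pow, PowerSeries.mk_one_pow_eq_mk_choose_add,
    PowerSeries.coeff_C_mul, PowerSeries.coeff_rescale, PowerSeries.coeff_mk, add_comm t d]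
  ring

/-- The number of entries of `a` that kill `ξ`. -/
noncomputable def rootMult {n : ℕ} (a : Fin n → ℕ) (ξ : ℂ) : ℕ :=
  #{i | ξ ^ a i = 1}

-- Each factor has simple roots, all among the roots of unity of order dividing `∏ i, a i`;
-- exchanging the two products counts how many factors vanish at `ξ`.
open Polynomial in
theorem prod_X_pow_sub_one {n : ℕ} (a : Fin n → ℕ) (ha : ∀ i, 0 < a i) :
    ∏ i, ((X : ℂ[X]) ^ a i - 1) =
      ∏ ξ ∈ nthRootsFinset (∏ i, a i) 1, (X - C ξ) ^ rootMult a ξ := by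
  have hL : 0 < ∏ i, a i := prod_pos fun i _ => ha i
  have h (i : Fin n) : (X : ℂ[X]) ^ a i - 1 =
      ∏ ξ ∈ nthRootsFinset (∏ i, a i) 1, if ξ ^ a i = 1 then X - C ξ else 1 := by
    rw [X_pow_sub_one_eq_prod (ha i) (Complex.isPrimitiveRoot_exp _ (ha i).ne'), ← prod_filter]
    congr 1
    ext ξ
    rw [mem_filter, mem_nthRootsFinset (ha i), mem_nthRootsFinset hL]
    refine ⟨fun h => ⟨?_, h⟩, fun h => h.2⟩
    obtain ⟨k, hk⟩ := dvd_prod_of_mem a (mem_univ i)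
    rw [hk, pow_mul, h, one_pow]
  simp_rw [h]
  rw [prod_comm]
  refine prod_congr rfl fun ξ _ => ?_
  rw [← prod_filter, prod_const, rootMult]

open Polynomial in
/-- The partial fraction decomposition of `1 / ∏ (X - ξ) ^ m ξ`, with denominators cleared. -/
theorem exists_partial_fractions (s : Finset ℂ) (m : ℂ → ℕ) (hpos : ∃ ξ ∈ s, 0 < m ξ) :
    ∃ r : (ξ : ℂ) → Fin (m ξ) → ℂ,
      (1 : ℂ[X]) = ∑ ξ ∈ s, ∑ j, C (r ξ j) * (X - C ξ) ^ (j : ℕ) *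
        ∏ η ∈ s.erase ξ, (X - C η) ^ m η := by
  obtain ⟨q, r, hr, h⟩ := eq_quo_mul_prod_pow_add_sum_rem_mul_prod_pow (s := s) (1 : ℂ[X])
    (g := fun ξ => X - C ξ) (fun ξ _ => monic_X_sub_C ξ)
    (fun ξ _ η _ hne => isCoprime_X_sub_C_of_isUnit_sub (sub_ne_zero.2 hne).isUnit) m
  have hr' : ∀ ξ ∈ s, ∀ j, r ξ j = C ((r ξ j).coeff 0) := fun ξ hξ j =>
    eq_C_of_degree_le_zero (Nat.WithBot.lt_one_iff_le_zero.1 (by simpa using hr ξ hξ j))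
  have hS : ∑ ξ ∈ s, ∑ j, r ξ j * (X - C ξ) ^ (j : ℕ) * ∏ η ∈ s.erase ξ, (X - C η) ^ m η =
      ∑ ξ ∈ s, ∑ j, C ((r ξ j).coeff 0) * (X - C ξ) ^ (j : ℕ) *
        ∏ η ∈ s.erase ξ, (X - C η) ^ m η :=
    sum_congr rfl fun ξ hξ => sum_congr rfl fun j _ => by rw [← hr' ξ hξ j]
  rw [hS] at h
  refine ⟨fun ξ j => (r ξ j).coeff 0, ?_⟩
  have hdeg (t : Finset ℂ) : (∏ η ∈ t, (X - C η) ^ m η).degree = ((∑ η ∈ t, m η : ℕ) : WithBot ℕ) := by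
    rw [degree_prod]
    simp
  -- Both `1` and the sum have degree below that of the full product, so the polynomial part `q` is
  -- zero. For `1` this uses that some multiplicity is positive.
  have hlt : (1 - ∑ ξ ∈ s, ∑ j, C ((r ξ j).coeff 0) * (X - C ξ) ^ (j : ℕ) *
        ∏ η ∈ s.erase ξ, (X - C η) ^ m η).degree < ((∑ η ∈ s, m η : ℕ) : WithBot ℕ) := by
    refine (degree_sub_le _ _).trans_lt (max_lt ?_ ?_)
    · obtain ⟨ξ, hξ, h0⟩ := hpos
      rw [degree_one]
      exact_mod_cast h0.trans_le (single_le_sum (f := m) (fun _ _ => Nat.zero_le _) hξ)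
    · refine (degree_sum_le _ _).trans_lt ((Finset.sup_lt_iff (WithBot.bot_lt_coe _)).2 ?_)
      intro ξ hξ
      refine (degree_sum_le _ _).trans_lt ((Finset.sup_lt_iff (WithBot.bot_lt_coe _)).2 ?_)
      intro j _
      rw [mul_assoc]
      refine ((degree_mul_le _ _).trans (add_le_add degree_C_le le_rfl)).trans_lt ?_
      rw [zero_add, degree_mul, hdeg, ← add_sum_erase s m hξ]
      simp only [degree_pow, degree_X_sub_C, nsmul_eq_mul, mul_one]
      exact_mod_cast Nat.add_lt_add_right j.2 _
  have hq : q = 0 := by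
    by_contra hq
    have h2 : q * ∏ η ∈ s, (X - C η) ^ m η = 1 - ∑ ξ ∈ s, ∑ j, C ((r ξ j).coeff 0) *
        (X - C ξ) ^ (j : ℕ) * ∏ η ∈ s.erase ξ, (X - C η) ^ m η := by
      linear_combination -h
    rw [← h2, degree_mul, hdeg, degree_eq_natDegree hq] at hlt
    norm_cast at hlt
    omega
  rwa [hq, zero_mul, zero_add] at h

open Polynomial in
/-- The denumerant as a sum of exponential polynomials. -/
theorem exists_denumerant_eq_sum {N : ℕ} (a : Fin (N + 1) → ℕ) (ha : ∀ i, 0 < a i) :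
    ∃ c : ℂ → ℕ → ℂ,
      (∀ ξ ∈ nthRootsFinset (∏ i, a i) (1 : ℂ), ∀ d, d + 1 = rootMult a ξ → c ξ d ≠ 0) ∧
      ∀ t, (denumerant a t : ℂ) = ∑ ξ ∈ nthRootsFinset (∏ i, a i) (1 : ℂ),
        ∑ d ∈ range (rootMult a ξ), c ξ d * ((t + d).choose d * ξ⁻¹ ^ t) := by
  have hL : 0 < ∏ i, a i := prod_pos fun i _ => ha i
  set s := nthRootsFinset (∏ i, a i) (1 : ℂ) with hs
  have h0 : ∀ ξ ∈ s, ξ ≠ 0 := fun ξ hξ => ne_zero_of_mem_nthRootsFinset one_ne_zero hξ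
  obtain ⟨r, hr⟩ := exists_partial_fractions s (rootMult a)
    ⟨1, one_mem_nthRootsFinset hL, by simp [rootMult]⟩
  -- Evaluated at `ξ`, every term vanishes except the one of `ξ` itself with `j = 0`, so that term
  -- cannot be zero.
  have hr0 : ∀ ξ ∈ s, ∀ h : 0 < rootMult a ξ, r ξ ⟨0, h⟩ ≠ 0 := by
    intro ξ hξ h hz
    have he := congrArg (eval ξ) hr
    rw [eval_one, eval_finsetSum, sum_eq_zero] at he
    · exact one_ne_zero he
    intro η hη
    rw [eval_finsetSum]
    refine sum_eq_zero fun j _ => ?_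
    rcases eq_or_ne ξ η with rfl | hne
    · rcases eq_or_ne (j : ℕ) 0 with hj | hj
      · have : j = ⟨0, h⟩ := Fin.ext hj
        simp [this, hz]
      · simp [hj]
    · rw [eval_mul, eval_prod, prod_eq_zero (mem_erase.2 ⟨hne, hξ⟩) (by simp [h.ne']), mul_zero]
  -- The numerator `(X - ξ) ^ j` leaves a pole of order `rootMult a ξ - j = d + 1`, hence the index
  -- `Fin.rev d`. The sign comes from using `X ^ a i - 1` instead of `1 - X ^ a i`.
  refine ⟨fun ξ d => if h : d < rootMult a ξ then
    (-1) ^ (N + 1) * r ξ (Fin.rev ⟨d, h⟩) * (-ξ⁻¹) ^ (d + 1) else 0, ?_, ?_⟩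
  · intro ξ hξ d hd
    have hlt : d < rootMult a ξ := by omega
    have h1 : Fin.rev ⟨d, hlt⟩ = ⟨0, by omega⟩ := Fin.ext (by rw [Fin.val_rev]; simp only; omega)
    simp only [hlt, dite_true, h1]
    exact mul_ne_zero (mul_ne_zero (pow_ne_zero _ (by norm_num)) (hr0 ξ hξ _))
      (pow_ne_zero _ (neg_ne_zero.2 (inv_ne_zero (h0 ξ hξ))))
  · intro t
    rw [denumerant_eq_coeff a ha]
    set G := ∏ i, multiplesSeries (a i) with hG
    have hGP : G * (∏ ξ ∈ s, (PowerSeries.X - PowerSeries.C ξ) ^ rootMult a ξ) =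
        PowerSeries.C ((-1) ^ (N + 1)) := by
      have h1 := congrArg (Polynomial.coeToPowerSeries.ringHom (R := ℂ)) (prod_X_pow_sub_one a ha)
      simp only [map_prod, map_pow, map_sub, Polynomial.coeToPowerSeries.ringHom_apply,
        Polynomial.coe_X, Polynomial.coe_C, Polynomial.coe_one] at h1
      rw [← h1, hG, ← prod_mul_distrib, prod_congr rfl fun i _ => multiplesSeries_mul (ha i)]
      simp
    have h1 := congrArg (Polynomial.coeToPowerSeries.ringHom (R := ℂ)) hr
    simp only [map_prod, map_pow, map_sub, map_sum, map_mul, map_one,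
      Polynomial.coeToPowerSeries.ringHom_apply, Polynomial.coe_X, Polynomial.coe_C] at h1
    rw [← mul_one G, h1, mul_sum, map_sum]
    refine sum_congr rfl fun ξ hξ => ?_
    rw [mul_sum, map_sum, ← Fin.sum_univ_eq_sum_range (fun d => _ * _)]
    rw [← Equiv.sum_comp Fin.revPerm]
    refine sum_congr rfl fun d _ => ?_
    have hd : (d : ℕ) + 1 + (Fin.rev d : ℕ) = rootMult a ξ := by
      rw [Fin.val_rev]; omega
    have h2 : G * (PowerSeries.C (r ξ (Fin.rev d)) *
          (PowerSeries.X - PowerSeries.C ξ) ^ (Fin.rev d : ℕ) *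
          ∏ η ∈ s.erase ξ, (PowerSeries.X - PowerSeries.C η) ^ rootMult a η) =
        PowerSeries.C ((-1) ^ (N + 1) * r ξ (Fin.rev d)) * invXSub ξ ^ ((d : ℕ) + 1) := by
      have h3 : invXSub ξ ^ ((d : ℕ) + 1) *
          (PowerSeries.X - PowerSeries.C ξ) ^ ((d : ℕ) + 1) = 1 := by
        rw [← mul_pow, invXSub_mul (h0 ξ hξ), one_pow]
      have h4 : (PowerSeries.X - PowerSeries.C ξ) ^ rootMult a ξ =
          (PowerSeries.X - PowerSeries.C ξ) ^ ((d : ℕ) + 1) *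
            (PowerSeries.X - PowerSeries.C ξ) ^ (Fin.rev d : ℕ) := by
        rw [← pow_add, hd]
      rw [map_mul, ← hGP, ← mul_prod_erase s _ hξ, h4]
      linear_combination (-G * PowerSeries.C (r ξ (Fin.rev d)) *
          (PowerSeries.X - PowerSeries.C ξ) ^ (Fin.rev d : ℕ) *
          ∏ η ∈ s.erase ξ, (PowerSeries.X - PowerSeries.C η) ^ rootMult a η) * h3
    rw [Fin.revPerm_apply, h2, PowerSeries.coeff_C_mul, coeff_invXSub_pow]
    simp only [Fin.is_lt, dite_true]
    ring

/-! ### Uniqueness of coefficients and independence of exponentials -/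

open Polynomial in
/-- The coefficients of a quasi-polynomial are determined by its values. -/
theorem coefficients_unique {K : Type*} [Field K] [CharZero K] {n : ℕ} {E F : Fin n → ℕ → K}
    (hE : ∀ k, ∃ q : ℕ, 0 < q ∧ Function.Periodic (E k) q)
    (hF : ∀ k, ∃ q : ℕ, 0 < q ∧ Function.Periodic (F k) q)
    (h : ∀ t : ℕ, ∑ k, E k t * (t : K) ^ (k : ℕ) = ∑ k, F k t * (t : K) ^ (k : ℕ)) : E = F := by
  choose p hp hpE using hE
  choose q hq hqF using hF
  set L := ∏ k, p k * q k with hL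
  have hL0 : 0 < L := prod_pos fun k _ => Nat.mul_pos (hp k) (hq k)
  have hEL (k : Fin n) : Function.Periodic (E k) L := by
    obtain ⟨d, hd⟩ := (dvd_mul_right (p k) (q k)).trans
      (dvd_prod_of_mem (fun k => p k * q k) (mem_univ k))
    rw [hL, hd, mul_comm]
    exact_mod_cast (hpE k).nat_mul d
  have hFL (k : Fin n) : Function.Periodic (F k) L := by
    obtain ⟨d, hd⟩ := (dvd_mul_left (q k) (p k)).trans
      (dvd_prod_of_mem (fun k => p k * q k) (mem_univ k))
    rw [hL, hd, mul_comm]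
    exact_mod_cast (hqF k).nat_mul d
  funext k r
  -- On the class of `r` modulo the common period `L` all coefficients are frozen, so `P` vanishes
  -- at infinitely many points.
  let P : K[X] := ∑ j, C (E j r - F j r) * X ^ (j : ℕ)
  have hP : P = 0 := by
    refine eq_zero_of_infinite_isRoot P (Set.Infinite.mono ?_
      (Set.infinite_range_of_injective (f := fun s : ℕ => ((r + s * L : ℕ) : K)) ?_))
    · rintro _ ⟨s, rfl⟩
      have h1 := h (r + s * L)
      have h2 (j : Fin n) : E j (r + s * L) = E j r := by
        simpa using (hEL j).nat_mul s r
      have h3 (j : Fin n) : F j (r + s * L) = F j r := by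
        simpa using (hFL j).nat_mul s r
      simp only [h2, h3] at h1
      simp only [P, Set.mem_ofPred_eq, IsRoot.def, eval_finsetSum, eval_mul, eval_C, eval_pow,
        eval_X, sub_mul, sum_sub_distrib, h1, sub_self]
    · intro s s' hs
      have : r + s * L = r + s' * L := Nat.cast_injective hs
      exact Nat.eq_of_mul_eq_mul_right hL0 (by omega)
  have hc : P.coeff k = E k r - F k r := by
    simp only [P, finsetSum_coeff, coeff_C_mul, coeff_X_pow, Fin.val_inj]
    simp
  rw [hP, coeff_zero] at hc
  exact (sub_eq_zero.1 hc.symm)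

/-- The functions `t ↦ ξ ^ (-t)` are linearly independent. -/
theorem eq_zero_of_sum_mul_inv_pow {s : Finset ℂ} {c : ℂ → ℂ}
    (h : ∀ t : ℕ, ∑ ξ ∈ s, c ξ * ξ⁻¹ ^ t = 0) : ∀ ξ ∈ s, c ξ = 0 := by
  -- Dedekind's independence of characters, for the monoid `ℕ`.
  have hli := (linearIndependent_monoidHom (Multiplicative ℕ) ℂ).comp
    (fun ξ : ℂ => powersHom ℂ ξ⁻¹) fun x y hxy => inv_injective ((powersHom ℂ).injective hxy)
  refine linearIndependent_iff'.1 hli s c (funext fun t => ?_)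
  simpa using h t.toAdd

/-! ### Constancy and periods of the coefficients -/

theorem rootMult_le {n : ℕ} (a : Fin n → ℕ) (ξ : ℂ) : rootMult a ξ ≤ n :=
  (card_le_univ _).trans_eq (Fintype.card_fin n)

theorem card_le_maxSize {n : ℕ} {a : Fin n → ℕ} {J : Finset (Fin n)} (h : J.gcd a ≠ 1) :
    #J ≤ maxSize a :=
  le_sup (f := card) (mem_filter.2 ⟨mem_univ J, h⟩)

theorem rootMult_le_maxSize {n : ℕ} (a : Fin n → ℕ) {ξ : ℂ} (h : ξ ≠ 1) :
    rootMult a ξ ≤ maxSize a := by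
  refine card_le_maxSize fun h1 => h ?_
  have h2 : orderOf ξ ∣ ({i | ξ ^ a i = 1} : Finset (Fin n)).gcd a :=
    dvd_gcd fun i hi => orderOf_dvd_of_pow_eq_one (mem_filter.1 hi).2
  rwa [h1, Nat.dvd_one, orderOf_eq_one_iff] at h2

theorem exists_gcd_ne_one_card_eq_maxSize {n : ℕ} {a : Fin n → ℕ} :
    ∃ J : Finset (Fin n), J.gcd a ≠ 1 ∧ #J = maxSize a := by
  -- The empty sublist, of gcd `0`, ensures that there is a candidate.
  obtain ⟨J, hJ, h⟩ := exists_mem_eq_sup (univ.filter fun J : Finset (Fin n) => J.gcd a ≠ 1)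
    ⟨∅, by simp⟩ card
  exact ⟨J, (mem_filter.1 hJ).2, h.symm⟩

theorem mem_gcdSet {n m f : ℕ} {a : Fin n → ℕ} :
    f ∈ gcdSet m a ↔ ∃ J : Finset (Fin n), m < #J ∧ J.gcd a = f := by
  simp [gcdSet]

/-- If the gcds of `I` and `J` share a factor, then `I ∪ J` has gcd different from `1`, hence at
most `ℓ` elements. As `I` and `J` have at least `ℓ`, both equal the union. -/
theorem gcdSet_pairwise_coprime {n k : ℕ} {a : Fin n → ℕ} (hk : k + 1 = maxSize a) :
    (gcdSet k a : Set ℕ).Pairwise Nat.Coprime := by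
  classical
  intro f hf g hg hne
  obtain ⟨I, hI, rfl⟩ := mem_gcdSet.1 hf
  obtain ⟨J, hJ, rfl⟩ := mem_gcdSet.1 hg
  by_contra h
  have h1 : (I ∪ J).gcd a ≠ 1 := by rwa [gcd_union]
  have h2 : #(I ∪ J) ≤ k + 1 := hk ▸ card_le_maxSize h1
  refine hne ?_
  rw [eq_of_subset_of_card_le (subset_union_left : I ⊆ I ∪ J) (by omega),
    ← eq_of_subset_of_card_le (subset_union_right : J ⊆ I ∪ J) (by omega)]

/-- The coefficient of degree `k` of the quasi-polynomial with parts `c ξ d`. -/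
noncomputable def coefficient {n : ℕ} (a : Fin n → ℕ) (c : ℂ → ℕ → ℂ) (k t : ℕ) : ℂ :=
  ∑ ξ ∈ Polynomial.nthRootsFinset (∏ i, a i) (1 : ℂ),
    (∑ d ∈ range (rootMult a ξ), c ξ d * (Polynomial.preHilbertPoly ℂ d 0).coeff k) * ξ⁻¹ ^ t

/-- As a function of `t`, `(t + d).choose d` is the polynomial `preHilbertPoly ℂ d 0`, of degree `d
< n`. -/
theorem sum_coefficient {n : ℕ} (a : Fin n → ℕ) (c : ℂ → ℕ → ℂ) (t : ℕ) :
    ∑ k : Fin n, coefficient a c k t * (t : ℂ) ^ (k : ℕ) =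
      ∑ ξ ∈ Polynomial.nthRootsFinset (∏ i, a i) (1 : ℂ),
        ∑ d ∈ range (rootMult a ξ), c ξ d * ((t + d).choose d * ξ⁻¹ ^ t) := by
  simp only [coefficient, sum_mul]
  rw [sum_comm]
  refine sum_congr rfl fun ξ _ => ?_
  rw [sum_comm]
  refine sum_congr rfl fun d hd => ?_
  have h := Polynomial.preHilbertPoly_eq_choose_sub_add ℂ d (Nat.zero_le t)
  rw [Polynomial.eval_eq_sum_range' (n := n), Nat.sub_zero] at h
  · rw [← h, sum_mul, mul_sum, ← Fin.sum_univ_eq_sum_range (fun k => c ξ d * (_ * _))]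
    exact sum_congr rfl fun k _ => by ring
  · rw [Polynomial.natDegree_preHilbertPoly]
    exact (mem_range.1 hd).trans_le (rootMult_le a ξ)

theorem coefficient_periodic {n : ℕ} (a : Fin n → ℕ) (c : ℂ → ℕ → ℂ) (k : ℕ) :
    Function.Periodic (coefficient a c k) (∏ i, a i) := by
  intro t
  refine sum_congr rfl fun ξ hξ => ?_
  rcases Nat.eq_zero_or_pos (∏ i, a i) with h | h
  · rw [h, add_zero]
  · rw [pow_add, inv_pow ξ (∏ i, a i), (Polynomial.mem_nthRootsFinset h 1).1 hξ, inv_one, mul_one]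

/-- The part of the coefficient of degree `k` that belongs to the root `ξ`, in the cases where
`ξ` has multiplicity at most `k + 1`. -/
theorem sum_coeff_preHilbertPoly (c : ℕ → ℂ) {m k : ℕ} (h : m ≤ k + 1) :
    ∑ d ∈ range m, c d * (Polynomial.preHilbertPoly ℂ d 0).coeff k =
      if m = k + 1 then c k * (k.factorial : ℂ)⁻¹ else 0 := by
  have h0 (d : ℕ) (hd : d < k) : c d * (Polynomial.preHilbertPoly ℂ d 0).coeff k = 0 := by
    rw [Polynomial.coeff_eq_zero_of_natDegree_lt, mul_zero]
    rwa [Polynomial.natDegree_preHilbertPoly]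
  split_ifs with hm
  · rw [hm, sum_range_succ, sum_eq_zero fun d hd => h0 d (mem_range.1 hd), zero_add,
      Polynomial.coeff_preHilbertPoly_self]
  · exact sum_eq_zero fun d hd => h0 d (by have := mem_range.1 hd; omega)

theorem coefficient_eq_of_maxSize_le {n : ℕ} (a : Fin n → ℕ) (c : ℂ → ℕ → ℂ) {k : ℕ}
    (hk : maxSize a ≤ k) (t : ℕ) : coefficient a c k t = coefficient a c k 0 := by
  refine sum_congr rfl fun ξ _ => ?_
  rcases eq_or_ne ξ 1 with rfl | hne
  · simp
  · have := rootMult_le_maxSize a hne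
    rw [sum_coeff_preHilbertPoly _ (by omega), if_neg (by omega), zero_mul, zero_mul]

/-- Only roots of multiplicity `k + 1` and `ξ = 1` matter. A primitive root of order `J.gcd a ≠ 1`
has this multiplicity, and independence of exponentials forces `ξ ^ q = 1`. Conversely, the order of
a root of that multiplicity divides the gcd of the entries killing it. -/
theorem periodic_coefficient_iff {n : ℕ} {a : Fin n → ℕ} (ha : ∀ i, 0 < a i) {c : ℂ → ℕ → ℂ}
    (hc : ∀ ξ ∈ Polynomial.nthRootsFinset (∏ i, a i) (1 : ℂ), ∀ d, d + 1 = rootMult a ξ → c ξ d ≠ 0)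
    {k : ℕ} (hk : k + 1 = maxSize a) (q : ℕ) :
    Function.Periodic (coefficient a c k) q ↔ ∀ f ∈ gcdSet k a, f ∣ q := by
  have hL : 0 < ∏ i, a i := prod_pos fun i _ => ha i
  constructor
  · intro hq f hf
    obtain ⟨J, hJ, rfl⟩ := mem_gcdSet.1 hf
    rcases eq_or_ne (J.gcd a) 1 with h1 | h1
    · rw [h1]; exact one_dvd q
    have hJ0 : J.gcd a ≠ 0 := by
      obtain ⟨i, hi⟩ := card_pos.1 (Nat.zero_lt_of_lt hJ)
      exact fun h => (ha i).ne' (gcd_eq_zero_iff.1 h i hi)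
    set ξ := Complex.exp (2 * Real.pi * Complex.I / (J.gcd a : ℕ)) with hξdef
    have hξ : IsPrimitiveRoot ξ (J.gcd a) := Complex.isPrimitiveRoot_exp _ hJ0
    have hpow (i : Fin n) (hi : i ∈ J) : ξ ^ a i = 1 :=
      (hξ.pow_eq_one_iff_dvd _).2 (gcd_dvd hi)
    have hξs : ξ ∈ Polynomial.nthRootsFinset (∏ i, a i) (1 : ℂ) := by
      obtain ⟨i, hi⟩ := card_pos.1 (Nat.zero_lt_of_lt hJ)
      rw [Polynomial.mem_nthRootsFinset hL, hξ.pow_eq_one_iff_dvd]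
      exact (gcd_dvd hi).trans (dvd_prod_of_mem a (mem_univ i))
    have hξ1 : ξ ≠ 1 := fun h => h1 (hξ.eq_orderOf.trans (by rw [h, orderOf_one]))
    have hm : rootMult a ξ = k + 1 := by
      refine le_antisymm (hk ▸ rootMult_le_maxSize a hξ1) (le_trans (Nat.succ_le_of_lt hJ) ?_)
      exact card_le_card fun i hi => mem_filter.2 ⟨mem_univ i, hpow i hi⟩
    have hz := eq_zero_of_sum_mul_inv_pow
      (s := Polynomial.nthRootsFinset (∏ i, a i) (1 : ℂ))
      (c := fun ξ => (∑ d ∈ range (rootMult a ξ),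
        c ξ d * (Polynomial.preHilbertPoly ℂ d 0).coeff k) * (ξ⁻¹ ^ q - 1))
      (fun t => by
        have h := sub_eq_zero.2 (hq t)
        rw [coefficient, coefficient, ← sum_sub_distrib] at h
        rw [← h]
        exact sum_congr rfl fun ξ _ => by rw [pow_add]; ring) ξ hξs
    rw [sum_coeff_preHilbertPoly _ hm.le, if_pos hm] at hz
    rcases mul_eq_zero.1 hz with h | h
    · exact absurd h (mul_ne_zero (hc ξ hξs k hm.symm)
        (inv_ne_zero (Nat.cast_ne_zero.2 k.factorial_ne_zero)))
    · rw [sub_eq_zero, inv_pow, inv_eq_one] at h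
      exact (hξ.pow_eq_one_iff_dvd q).1 h
  · intro h t
    refine sum_congr rfl fun ξ _ => ?_
    rcases eq_or_ne ξ 1 with rfl | hne
    · simp
    have hle : rootMult a ξ ≤ k + 1 := hk ▸ rootMult_le_maxSize a hne
    rw [sum_coeff_preHilbertPoly _ hle]
    split_ifs with hm
    · have h2 : orderOf ξ ∣ ({i | ξ ^ a i = 1} : Finset (Fin n)).gcd a :=
        dvd_gcd fun i hi => orderOf_dvd_of_pow_eq_one (mem_filter.1 hi).2
      have h3 : ({i | ξ ^ a i = 1} : Finset (Fin n)).gcd a ∣ q :=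
        h _ (mem_gcdSet.2 ⟨_, by rw [← rootMult, hm]; omega, rfl⟩)
      rw [pow_add, inv_pow ξ q, orderOf_dvd_iff_pow_eq_one.1 (h2.trans h3), inv_one, mul_one]
    · simp

theorem exists_complex_coefficients {N : ℕ} {a : Fin (N + 1) → ℕ} (ha : ∀ i, 0 < a i) :
    ∃ c : ℂ → ℕ → ℂ,
      (∀ ξ ∈ Polynomial.nthRootsFinset (∏ i, a i) (1 : ℂ),
        ∀ d, d + 1 = rootMult a ξ → c ξ d ≠ 0) ∧
      (∃ E, IsCoefficients a E) ∧
      ∀ E, IsCoefficients a E → ∀ k t, (E k t : ℂ) = coefficient a c k t := by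
  obtain ⟨c, hc, hsum⟩ := exists_denumerant_eq_sum a ha
  have hL : 0 < ∏ i, a i := prod_pos fun i _ => ha i
  have hsum' (t : ℕ) := (hsum t).trans (sum_coefficient a c t).symm
  refine ⟨c, hc, ?_, fun E hE k t => ?_⟩
  -- A `ℚ`-linear retraction `π : ℂ → ℚ` makes the complex coefficients rational without changing
  -- the identity, since the denumerant and the powers of `t` are rational.
  · obtain ⟨π, hπ⟩ := LinearMap.exists_leftInverse_of_injective (Algebra.linearMap ℚ ℂ)
      (LinearMap.ker_eq_bot.2 (algebraMap ℚ ℂ).injective)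
    refine ⟨fun k t => π (coefficient a c k t),
      fun k => ⟨_, hL, fun t => congrArg π (coefficient_periodic a c k t)⟩, fun t => ?_⟩
    have h1 (x : ℚ) : π (x : ℂ) = x := LinearMap.congr_fun hπ x
    have h2 := congrArg π (hsum' t)
    rw [map_sum, show ((denumerant a t : ℕ) : ℂ) = ((denumerant a t : ℚ) : ℂ) by push_cast; rfl,
      h1] at h2
    rw [h2]
    refine sum_congr rfl fun k _ => ?_
    rw [show coefficient a c k t * (t : ℂ) ^ (k : ℕ) =
      ((t : ℚ) ^ (k : ℕ)) • coefficient a c k t by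
        rw [Algebra.smul_def, mul_comm]; simp, map_smul, smul_eq_mul, mul_comm]
  · refine congrFun (congrFun (coefficients_unique (E := fun k t => (E k t : ℂ))
      (F := fun (k : Fin (N + 1)) t => coefficient a c k t) ?_ ?_ ?_) k) t
    · exact fun k => (hE.1 k).imp fun q hq => ⟨hq.1, fun t => congrArg Rat.cast (hq.2 t)⟩
    · exact fun k => ⟨_, hL, coefficient_periodic a c k⟩
    · intro t
      rw [← hsum' t]
      exact_mod_cast (hE.2 t).symm

theorem coefficients_spec {N : ℕ} {a : Fin (N + 1) → ℕ} (ha : ∀ i, 0 < a i) :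
    (∃! E : Fin (N + 1) → ℕ → ℚ, IsCoefficients a E) ∧
    ∀ E : Fin (N + 1) → ℕ → ℚ, IsCoefficients a E →
      (∀ k : Fin (N + 1), maxSize a ≤ (k : ℕ) → ∃ c : ℚ, ∀ t, E k t = c) ∧
      (∀ k : Fin (N + 1), (k : ℕ) + 1 = maxSize a →
        (¬ ∃ c : ℚ, ∀ t, E k t = c) ∧
        (gcdSet k a : Set ℕ).Pairwise Nat.Coprime ∧
        IsLeast {q : ℕ | 0 < q ∧ Function.Periodic (E k) q} (∏ f ∈ gcdSet k a, f)) := by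
  obtain ⟨c, hc, ⟨E₀, hE₀⟩, hE⟩ := exists_complex_coefficients ha
  refine ⟨⟨E₀, hE₀, fun E h => coefficients_unique h.1 hE₀.1 fun t => ?_⟩, fun E h => ⟨?_, ?_⟩⟩
  · rw [← h.2 t, ← hE₀.2 t]
  · intro k hk
    refine ⟨E k 0, fun t => ?_⟩
    have := coefficient_eq_of_maxSize_le a c hk t
    rw [← hE E h, ← hE E h] at this
    exact_mod_cast this
  · intro k hk
    have hper (q : ℕ) : Function.Periodic (E k) q ↔ ∀ f ∈ gcdSet k a, f ∣ q := by
      rw [← periodic_coefficient_iff ha hc hk q]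
      refine forall_congr' fun t => ?_
      rw [← hE E h, ← hE E h, Rat.cast_inj]
    have hcop := gcdSet_pairwise_coprime hk
    refine ⟨?_, hcop, ⟨?_, ?_⟩, ?_⟩
    · rintro ⟨x, hx⟩
      obtain ⟨J, hJ, hJc⟩ := exists_gcd_ne_one_card_eq_maxSize (a := a)
      -- A constant function has period `1`, which would force a gcd different from `1` to divide
      -- `1`.
      have := (hper 1).1 (fun t => by rw [hx, hx]) _ (mem_gcdSet.2 ⟨J, by omega, rfl⟩)
      exact hJ (Nat.dvd_one.1 this)
    · refine prod_pos fun f hf => ?_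
      obtain ⟨J, hJ, rfl⟩ := mem_gcdSet.1 hf
      obtain ⟨i, hi⟩ := card_pos.1 (Nat.zero_lt_of_lt hJ)
      exact Nat.pos_of_ne_zero fun h => (ha i).ne' (gcd_eq_zero_iff.1 h i hi)
    · exact (hper _).2 fun f hf => dvd_prod_of_mem (fun f => f) hf
    · rintro q ⟨hq, hq'⟩
      refine Nat.le_of_dvd hq ?_
      refine Finset.prod_dvd_of_isRelPrime (fun f hf g hg hne => ?_) ((hper q).1 hq')
      exact Nat.coprime_iff_isRelPrime.1 (hcop hf hg hne)

/-! ### Reduction to the largest multiplicity of a prime -/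

/-- The prime divisors of the entries of a list of factored numbers, one occurrence per entry. -/
def primesOf (L : List FactoredNat) : List ℕ :=
  L.flatMap fun x => x.factors.map Prod.fst

theorem FactoredNat.prime_of_mem {x : FactoredNat} {p : ℕ} (h : p ∈ x.factors.map Prod.fst) :
    p.Prime := by
  obtain ⟨pe, hpe, rfl⟩ := List.mem_map.1 h
  exact x.prime pe hpe

theorem FactoredNat.dvd_value_iff (x : FactoredNat) {p : ℕ} (hp : p.Prime) :
    p ∣ x.value ↔ p ∈ x.factors.map Prod.fst := by
  rw [value, hp.prime.dvd_prod_iff]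
  simp only [List.mem_map]
  constructor
  · rintro ⟨_, ⟨pe, hpe, rfl⟩, h⟩
    exact ⟨pe, hpe, ((Nat.prime_dvd_prime_iff_eq hp (x.prime pe hpe)).1
      (hp.dvd_of_dvd_pow h)).symm⟩
  · rintro ⟨pe, hpe, rfl⟩
    exact ⟨_, ⟨pe, hpe, rfl⟩, dvd_pow_self _ (x.pos pe hpe).ne'⟩

/-- The primes listed for one entry are distinct, so an entry contributes at most one occurrence. -/
theorem count_primesOf (L : List FactoredNat) {p : ℕ} (hp : p.Prime) :
    (primesOf L).count p = #{i : Fin L.length | p ∣ (L.get i).value} := by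
  have h (x : FactoredNat) : (x.factors.map Prod.fst).count p = if p ∣ x.value then 1 else 0 := by
    rw [List.Nodup.count x.nodup]
    simp only [x.dvd_value_iff hp]
  rw [primesOf, List.count_flatMap, card_filter, ← List.sum_ofFn]
  have h2 := List.map_ofFn (f := L.get) (g := fun x => if p ∣ x.value then 1 else 0)
  rw [List.ofFn_get] at h2
  refine congrArg List.sum ((List.map_congr_left fun x _ => h x).trans h2)

theorem count_primesOf_le (L : List FactoredNat) (p : ℕ) :
    (primesOf L).count p ≤ maxSizeFactored L := by
  by_cases h : p ∈ primesOf L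
  · obtain ⟨x, _, hx⟩ := List.mem_flatMap.1 h
    have hp := x.prime_of_mem hx
    rw [count_primesOf L hp]
    refine card_le_maxSize fun h1 => hp.one_lt.ne' (Nat.dvd_one.1 (h1 ▸ ?_))
    exact dvd_gcd fun i hi => (mem_filter.1 hi).2
  · rw [List.count_eq_zero_of_not_mem h]
    exact Nat.zero_le _

theorem exists_maxSizeFactored_le (L : List FactoredNat) :
    ∃ p, maxSizeFactored L ≤ (primesOf L).count p := by
  obtain ⟨J, hJ, hc⟩ := exists_gcd_ne_one_card_eq_maxSize
    (a := fun i : Fin L.length => (L.get i).value)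
  obtain ⟨p, hp, hdvd⟩ := Nat.exists_prime_and_dvd hJ
  refine ⟨p, ?_⟩
  rw [count_primesOf L hp, maxSizeFactored, ← hc]
  exact card_le_card fun i hi => mem_filter.2 ⟨mem_univ i, hdvd.trans (gcd_dvd hi)⟩

/-- The maximum of `m` and of the multiplicities of the entries of a list. -/
def maxCount {α : Type*} [BEq α] : ℕ → List α → ℕ
  | m, [] => m
  | m, w :: l => maxCount (max m (l.count w + 1)) l

/-- The first occurrence of `w` sees all other occurrences behind it. -/
theorem le_maxCount {α : Type*} [BEq α] [LawfulBEq α] (m : ℕ) (l : List α) :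
    m ≤ maxCount m l ∧ ∀ w, l.count w ≤ maxCount m l := by
  induction l generalizing m with
  | nil => simp [maxCount]
  | cons v l ih =>
    obtain ⟨h1, h2⟩ := ih (max m (l.count v + 1))
    rw [maxCount]
    refine ⟨(le_max_left _ _).trans h1, fun w => ?_⟩
    by_cases hne : w = v
    · subst hne
      rw [List.count_cons_self]
      exact (le_max_right _ _).trans h1
    · rw [List.count_cons_of_ne (Ne.symm hne)]
      exact h2 w

theorem maxCount_eq_or {α : Type*} [BEq α] [LawfulBEq α] (m : ℕ) (l : List α) :
    maxCount m l = m ∨ ∃ w, maxCount m l ≤ l.count w := by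
  induction l generalizing m with
  | nil => simp [maxCount]
  | cons v l ih =>
    rw [maxCount]
    rcases ih (max m (l.count v + 1)) with h | ⟨w, h⟩
    · rw [h]
      rcases max_choice m (l.count v + 1) with h' | h'
      · exact .inl h'
      · exact .inr ⟨v, by rw [h', List.count_cons_self]⟩
    · exact .inr ⟨w, h.trans List.count_le_count_cons⟩

theorem maxCount_zero_le_length {α : Type*} [BEq α] [LawfulBEq α] (l : List α) :
    maxCount 0 l ≤ l.length := by
  rcases maxCount_eq_or 0 l with h | ⟨w, h⟩
  · rw [h]; exact Nat.zero_le _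
  · exact h.trans List.count_le_length

/-- The keys that the machine compares: the reversed binary expansions of the primes. -/
def wordsOf (ps : List ℕ) : List (List Symbol) :=
  (ps.map fun p => (encodeNumber p).reverse).reverse

instance : DecidableEq Symbol := fun x y => by
  cases x <;> cases y <;> first | exact isTrue rfl | exact isFalse nofun

theorem encodeNumber_injective : Function.Injective encodeNumber := by
  intro p q h
  refine Computability.encodingNatBool.encode_injective (List.map_injective_iff.2 ?_ h)
  intro x y
  cases x <;> cases y <;> simp

theorem count_wordsOf (ps : List ℕ) (p : ℕ) :
    (wordsOf ps).count (encodeNumber p).reverse = ps.count p := by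
  rw [wordsOf, List.count_reverse,
    List.count_map_of_injective _ (fun p => (encodeNumber p).reverse)
      fun p q h => encodeNumber_injective (List.reverse_injective h)]

theorem maxCount_wordsOf (L : List FactoredNat) :
    maxCount 0 (wordsOf (primesOf L)) = maxSizeFactored L := by
  apply le_antisymm
  · rcases maxCount_eq_or 0 (wordsOf (primesOf L)) with h | ⟨w, h⟩
    · rw [h]; exact Nat.zero_le _
    · refine h.trans ?_
      by_cases hw : w ∈ wordsOf (primesOf L)
      · obtain ⟨p, _, rfl⟩ := List.mem_map.1 (List.mem_reverse.1 hw)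
        rw [count_wordsOf]
        exact count_primesOf_le L p
      · rw [List.count_eq_zero_of_not_mem hw]
        exact Nat.zero_le _
  · obtain ⟨p, hp⟩ := exists_maxSizeFactored_le L
    rw [← count_wordsOf] at hp
    exact hp.trans ((le_maxCount _ _).2 _)

end

/-! ### The stack machine -/

namespace Machine

open Turing TM2.Stmt

instance : Fintype Symbol :=
  ⟨{.zero, .one, .pow, .times, .comma}, fun x => by cases x <;> simp⟩

/-- The stacks of the machine. -/
inductive Stack where
  | input
  | keys
  | seen
  | key
  | checked
  | best
  | current
  | output
  deriving DecidableEq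

instance : Fintype Stack :=
  ⟨{.input, .keys, .seen, .key, .checked, .best, .current, .output}, fun x => by cases x <;> simp⟩

/-- The labels of the machine. -/
inductive Label where
  | start
  | base
  | exponent
  | take
  | restore
  | scan
  | clear
  | unscan
  | merge
  | count
  | increment
  | carry
  deriving DecidableEq

instance : Fintype Label :=
  ⟨{.start, .base, .exponent, .take, .restore, .scan, .clear, .unscan, .merge, .count, .increment,
    .carry}, fun x => by cases x <;> simp⟩

/-- The alphabets of the stacks. -/
@[reducible] def Alphabet : Stack → Type
  | .output => Bool
  | _ => Symbol

/-- The internal memory: two symbols and the result of a comparison. -/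
abbrev Memory := Option Symbol × Option Symbol × Bool

/-- Forget the symbols in memory and go to the label `l`. -/
def jump (l : Label) : TM2.Stmt Alphabet Label Memory :=
  load (fun v => (none, none, v.2.2)) <| goto fun _ => l

/-- Pop a symbol from the stack `k`, then execute `q` if there is none and `r` otherwise. -/
def popThen (k : Stack) (f : Alphabet k → Symbol) (q r : TM2.Stmt Alphabet Label Memory) :
    TM2.Stmt Alphabet Label Memory :=
  pop k (fun v x => (x.map f, v.2)) <| branch (fun v => v.1.isNone) q r

/-- The symbol that was popped last. -/
def top (v : Memory) : Symbol := v.1.getD .one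

/-- Whether the symbols in memory agree, where `pow` marks the end of a key. -/
def agree (v : Memory) : Bool :=
  if v.1 = some .pow then v.2.1 = none else v.1 = v.2.1

/-- The program of the machine. It first copies the reversed primes to `keys`, each followed by
`pow`. Then it repeatedly takes a key and compares it with all keys below it, which moves a unit
from `best` to `current` for every match. Finally it converts `best` from unary to binary. -/
def program : Label → TM2.Stmt Alphabet Label Memory
  | .start => popThen .input id (jump .take) <|
      branch (fun v => v.1 = some .comma) (jump .start) <|
        push .keys (fun _ => Symbol.pow) <| push .keys top <| jump .base
  -- The `halt` branches here and in `exponent` are not reached on encoded inputs.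
  | .base => popThen .input id halt <|
      branch (fun v => v.1 = some .pow) (jump .exponent) <| push .keys top <| jump .base
  | .exponent => popThen .input id halt <|
      branch (fun v => v.1 = some .times) (jump .start) (jump .exponent)
  | .take => popThen .keys id (jump .count) <|
      branch (fun v => v.1 = some .pow) (jump .restore) <| push .checked top <| jump .take
  | .restore => popThen .checked id
      -- The flag is also true just after `take`, so a key counts itself. Popping an empty `best`
      -- changes nothing, which gives truncated subtraction.
      (branch (fun v => v.2.2)
        (pop .best (fun v _ => v) <| push .current (fun _ => Symbol.one) <| jump .scan)
        (load (fun v => (v.1, v.2.1, true)) <| jump .scan))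
      (push .key top <| jump .restore)
  | .scan => pop .key (fun v x => (v.1, x, v.2.2)) <| popThen .keys id (jump .clear) <|
      load (fun v => (v.1, v.2.1, v.2.2 && agree v)) <|
      push .seen top <|
      branch (fun v => v.2.1.isNone)
        (branch (fun v => v.1 = some .pow) (jump .restore) (jump .scan))
        (push .checked (fun v => v.2.1.getD .one) <|
          branch (fun v => v.1 = some .pow) (jump .restore) (jump .scan))
  | .clear => popThen .key id (jump .unscan) (jump .clear)
  | .unscan => popThen .seen id (jump .merge) (push .keys top <| jump .unscan)
  | .merge => popThen .current id (jump .take) (push .best top <| jump .merge)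
  -- The memory is reset because a halting configuration must carry the initial state.
  | .count => popThen .best id (load (fun _ => (none, none, true)) halt) (jump .increment)
  | .increment => popThen .output (fun b => cond b .one .zero)
      (push .output (fun _ => true) <| jump .carry)
      (branch (fun v => v.1 = some .one) (push .checked top <| jump .increment)
        (push .output (fun _ => true) <| jump .carry))
  | .carry => popThen .checked id (jump .count) (push .output (fun _ => false) <| jump .carry)

/-- The machine that computes the largest multiplicity of a prime. -/
def machine : FinTM2 where
  K := Stack
  k₀ := .input
  k₁ := .output
  Γ := Alphabet
  Λ := Label
  main := .start
  σ := Memory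
  initialState := (none, none, true)
  Γk₀Fin := inferInstanceAs (Fintype Symbol)
  m := program

/-- The contents of the stacks. -/
def contents (i a b k c m n : List Symbol) (o : List Bool) : ∀ s, List (Alphabet s)
  | .input => i
  | .keys => a
  | .seen => b
  | .key => k
  | .checked => c
  | .best => m
  | .current => n
  | .output => o

section update

variable (i a b k c m n x : List Symbol) (o y : List Bool)

@[simp] theorem update_input : Function.update (contents i a b k c m n o) .input x =
    contents x a b k c m n o := by
  funext s; cases s <;> rfl

@[simp] theorem update_keys : Function.update (contents i a b k c m n o) .keys x =
    contents i x b k c m n o := by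
  funext s; cases s <;> rfl

@[simp] theorem update_seen : Function.update (contents i a b k c m n o) .seen x =
    contents i a x k c m n o := by
  funext s; cases s <;> rfl

@[simp] theorem update_key : Function.update (contents i a b k c m n o) .key x =
    contents i a b x c m n o := by
  funext s; cases s <;> rfl

@[simp] theorem update_checked : Function.update (contents i a b k c m n o) .checked x =
    contents i a b k x m n o := by
  funext s; cases s <;> rfl

@[simp] theorem update_best : Function.update (contents i a b k c m n o) .best x =
    contents i a b k c x n o := by
  funext s; cases s <;> rfl

@[simp] theorem update_current : Function.update (contents i a b k c m n o) .current x =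
    contents i a b k c m x o := by
  funext s; cases s <;> rfl

@[simp] theorem update_output : Function.update (contents i a b k c m n o) .output y =
    contents i a b k c m n y := by
  funext s; cases s <;> rfl

end update

/-- The configurations of the machine. -/
abbrev Configuration := TM2.Cfg Alphabet Label Memory

/-- A configuration without symbols in memory. -/
def config (l : Label) (f : Bool) (i a b k c m n : List Symbol) (o : List Bool) : Configuration :=
  ⟨some l, (none, none, f), contents i a b k c m n o⟩

/-- The machine goes from `x` to `y` in at most `t` steps. -/
def Reach (t : ℕ) (x y : Configuration) : Prop :=
  ∃ s ≤ t, (flip bind (TM2.step program))^[s] (some x) = some y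

theorem Reach.refl (x : Configuration) : Reach 0 x x := ⟨0, le_rfl, rfl⟩

theorem Reach.mono {s t : ℕ} {x y : Configuration} (h : Reach s x y) (hst : s ≤ t) : Reach t x y :=
  h.imp fun _ h => ⟨h.1.trans hst, h.2⟩

theorem Reach.trans {s t : ℕ} {x y z : Configuration} (h : Reach s x y) (h' : Reach t y z) :
    Reach (s + t) x z := by
  obtain ⟨u, hu, hxy⟩ := h
  obtain ⟨v, hv, hyz⟩ := h'
  exact ⟨v + u, by omega, by rw [Function.iterate_add_apply, hxy, hyz]⟩

theorem Reach.single {x y : Configuration} (h : TM2.step program x = some y) : Reach 1 x y :=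
  ⟨1, le_rfl, h⟩

/-! ### Single steps of the machine -/

section steps

attribute [local simp] Alphabet config program popThen jump contents TM2.step TM2.stepAux top agree

variable {f : Bool} {i a b k c m n : List Symbol} {o : List Bool}

theorem step_start_nil :
    TM2.step program (config .start f [] a b k c m n o) =
      some (config .take f [] a b k c m n o) := by
  simp

theorem step_start_comma :
    TM2.step program (config .start f (.comma :: i) a b k c m n o) =
      some (config .start f i a b k c m n o) := by
  simp

theorem step_start_cons {x : Symbol} (h : x ≠ .comma) :
    TM2.step program (config .start f (x :: i) a b k c m n o) =
      some (config .base f i (x :: .pow :: a) b k c m n o) := by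
  simp [h]

theorem step_base_pow :
    TM2.step program (config .base f (.pow :: i) a b k c m n o) =
      some (config .exponent f i a b k c m n o) := by
  simp

theorem step_base_cons {x : Symbol} (h : x ≠ .pow) :
    TM2.step program (config .base f (x :: i) a b k c m n o) =
      some (config .base f i (x :: a) b k c m n o) := by
  simp [h]

theorem step_exponent_times :
    TM2.step program (config .exponent f (.times :: i) a b k c m n o) =
      some (config .start f i a b k c m n o) := by
  simp

theorem step_exponent_cons {x : Symbol} (h : x ≠ .times) :
    TM2.step program (config .exponent f (x :: i) a b k c m n o) =
      some (config .exponent f i a b k c m n o) := by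
  simp [h]

theorem step_take_nil :
    TM2.step program (config .take f i [] b k c m n o) =
      some (config .count f i [] b k c m n o) := by
  simp

theorem step_take_pow :
    TM2.step program (config .take f i (.pow :: a) b k c m n o) =
      some (config .restore f i a b k c m n o) := by
  simp

theorem step_take_cons {x : Symbol} (h : x ≠ .pow) :
    TM2.step program (config .take f i (x :: a) b k c m n o) =
      some (config .take f i a b k (x :: c) m n o) := by
  simp [h]

theorem step_restore_cons {x : Symbol}  :
    TM2.step program (config .restore f i a b k (x :: c) m n o) =
      some (config .restore f i a b (x :: k) c m n o) := by
  simp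

theorem step_restore_true :
    TM2.step program (config .restore true i a b k [] m n o) =
      some (config .scan true i a b k [] (m.tail) (.one :: n) o) := by
  simp

theorem step_restore_false :
    TM2.step program (config .restore false i a b k [] m n o) =
      some (config .scan true i a b k [] m n o) := by
  simp

theorem step_scan_nil :
    TM2.step program (config .scan f i [] b k c m n o) =
      some (config .clear f i [] b (k.tail) c m n o) := by
  simp

theorem step_scan_cons_nil {x : Symbol} (h : x ≠ .pow) :
    TM2.step program (config .scan f i (x :: a) b [] c m n o) =
      some (config .scan false i a (x :: b) [] c m n o) := by
  simp [h]

theorem step_scan_cons_cons {x y : Symbol} (h : x ≠ .pow) :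
    TM2.step program (config .scan f i (x :: a) b (y :: k) c m n o) =
      some (config .scan (f && decide (x = y)) i a (x :: b) k (y :: c) m n o) := by
  simp [h]

theorem step_scan_pow_nil :
    TM2.step program (config .scan f i (.pow :: a) b [] c m n o) =
      some (config .restore f i a (.pow :: b) [] c m n o) := by
  simp

theorem step_scan_pow_cons {y : Symbol} :
    TM2.step program (config .scan f i (.pow :: a) b (y :: k) c m n o) =
      some (config .restore false i a (.pow :: b) k (y :: c) m n o) := by
  simp

theorem step_clear_nil :
    TM2.step program (config .clear f i a b [] c m n o) =
      some (config .unscan f i a b [] c m n o) := by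
  simp

theorem step_clear_cons {x : Symbol}  :
    TM2.step program (config .clear f i a b (x :: k) c m n o) =
      some (config .clear f i a b k c m n o) := by
  simp

theorem step_unscan_nil :
    TM2.step program (config .unscan f i a [] k c m n o) =
      some (config .merge f i a [] k c m n o) := by
  simp

theorem step_unscan_cons {x : Symbol}  :
    TM2.step program (config .unscan f i a (x :: b) k c m n o) =
      some (config .unscan f i (x :: a) b k c m n o) := by
  simp

theorem step_merge_nil :
    TM2.step program (config .merge f i a b k c m [] o) =
      some (config .take f i a b k c m [] o) := by
  simp

theorem step_merge_cons {x : Symbol}  :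
    TM2.step program (config .merge f i a b k c m (x :: n) o) =
      some (config .merge f i a b k c (x :: m) n o) := by
  simp

theorem step_count_nil :
    TM2.step program (config .count f i a b k c [] n o) =
      some (⟨none, (none, none, true), contents i a b k c [] n o⟩) := by
  simp

theorem step_count_cons {x : Symbol}  :
    TM2.step program (config .count f i a b k c (x :: m) n o) =
      some (config .increment f i a b k c m n o) := by
  simp

theorem step_increment_nil :
    TM2.step program (config .increment f i a b k c m n []) =
      some (config .carry f i a b k c m n ([true])) := by
  simp

theorem step_increment_false :
    TM2.step program (config .increment f i a b k c m n (false :: o)) =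
      some (config .carry f i a b k c m n (true :: o)) := by
  simp

theorem step_increment_true :
    TM2.step program (config .increment f i a b k c m n (true :: o)) =
      some (config .increment f i a b k (.one :: c) m n o) := by
  simp

theorem step_carry_nil :
    TM2.step program (config .carry f i a b k [] m n o) =
      some (config .count f i a b k [] m n o) := by
  simp

theorem step_carry_cons {x : Symbol}  :
    TM2.step program (config .carry f i a b k (x :: c) m n o) =
      some (config .carry f i a b k c m n (false :: o)) := by
  simp

end steps

/-! ### Reading the input and comparing keys -/

/-- The contents of the stack `keys` for a list of keys. -/
def joinWords (W : List (List Symbol)) : List Symbol :=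
  W.flatMap fun w => w ++ [.pow]

theorem joinWords_cons (w : List Symbol) (W : List (List Symbol)) :
    joinWords (w :: W) = w ++ .pow :: joinWords W := by
  simp [joinWords]

theorem joinWords_append (W V : List (List Symbol)) :
    joinWords (W ++ V) = joinWords W ++ joinWords V := by
  simp [joinWords]

theorem length_le_length_joinWords (W : List (List Symbol)) :
    W.length ≤ (joinWords W).length := by
  induction W with
  | nil => exact le_rfl
  | cons w W ih =>
    rw [joinWords_cons]
    simp only [List.length_cons, List.length_append]
    omega

section reach

variable {f : Bool} {i a b k c m n : List Symbol} {o : List Bool}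

theorem reach_base (w : List Symbol) (hw : .pow ∉ w) (a : List Symbol) :
    Reach (w.length + 1) (config .base f (w ++ .pow :: i) a b k c m n o)
      (config .exponent f i (w.reverse ++ a) b k c m n o) := by
  induction w generalizing a with
  | nil => exact .single step_base_pow
  | cons x w ih =>
    rw [List.mem_cons, not_or] at hw
    rw [List.reverse_cons, List.append_assoc]
    exact ((Reach.single (step_base_cons (Ne.symm hw.1))).trans (ih hw.2 (x :: a))).mono
      (by rw [List.length_cons]; omega)

theorem reach_exponent (w : List Symbol) (hw : .times ∉ w) :
    Reach (w.length + 1) (config .exponent f (w ++ .times :: i) a b k c m n o)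
      (config .start f i a b k c m n o) := by
  induction w with
  | nil => exact .single step_exponent_times
  | cons x w ih =>
    rw [List.mem_cons, not_or] at hw
    exact ((Reach.single (step_exponent_cons (Ne.symm hw.1))).trans (ih hw.2)).mono
      (by rw [List.length_cons]; omega)

theorem mem_encodeNumber {p : ℕ} {x : Symbol} (h : x ∈ encodeNumber p) : x = .zero ∨ x = .one := by
  obtain ⟨y, _, rfl⟩ := List.mem_map.1 h
  cases y
  · exact .inl rfl
  · exact .inr rfl

theorem encodeNumber_ne_nil {p : ℕ} (hp : p ≠ 0) : encodeNumber p ≠ [] := by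
  intro h
  have h1 : Computability.encodeNat p = [] := List.map_eq_nil_iff.1 h
  have h2 := Computability.decode_encodeNat p
  rw [h1] at h2
  exact hp h2.symm

/-- One step per symbol. Since `p ≠ 0`, its expansion has a first digit, on which `start` also
pushes the separator. -/
theorem reach_factor {p : ℕ} (hp : p ≠ 0) (e : ℕ) :
    Reach (encodeNumber p ++ [Symbol.pow] ++ encodeNumber e ++ [Symbol.times]).length
      (config .start f (encodeNumber p ++ [Symbol.pow] ++ encodeNumber e ++ [Symbol.times] ++ i)
        a b k c m n o)
      (config .start f i ((encodeNumber p).reverse ++ .pow :: a) b k c m n o) := by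
  have h1 : .pow ∉ encodeNumber p := fun h => by simpa using mem_encodeNumber h
  have h2 : .times ∉ encodeNumber e := fun h => by simpa using mem_encodeNumber h
  have h3 : .comma ∉ encodeNumber p := fun h => by simpa using mem_encodeNumber h
  obtain ⟨x, w, hw⟩ := List.exists_cons_of_ne_nil (encodeNumber_ne_nil hp)
  rw [hw] at h1 h3 ⊢
  rw [List.mem_cons, not_or] at h1 h3
  simp only [List.append_assoc, List.cons_append, List.nil_append, List.reverse_cons]
  exact ((Reach.single (step_start_cons (Ne.symm h3.1))).trans
    ((reach_base w h1.2 _).trans (reach_exponent _ h2))).mono (by simp; omega)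

theorem reach_factors (l : List (ℕ × ℕ)) (hl : ∀ pe ∈ l, pe.1.Prime) (a : List Symbol) :
    Reach (l.flatMap fun pe =>
        encodeNumber pe.1 ++ [Symbol.pow] ++ encodeNumber pe.2 ++ [Symbol.times]).length
      (config .start f ((l.flatMap fun pe =>
        encodeNumber pe.1 ++ [Symbol.pow] ++ encodeNumber pe.2 ++ [Symbol.times]) ++ i)
        a b k c m n o)
      (config .start f i (joinWords (wordsOf (l.map Prod.fst)) ++ a) b k c m n o) := by
  induction l generalizing a with
  | nil => exact .refl _
  | cons pe l ih =>
    have h := (reach_factor (f := f) (a := a) (b := b) (k := k) (c := c) (m := m) (n := n) (o := o)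
      (i := (l.flatMap fun pe =>
        encodeNumber pe.1 ++ [Symbol.pow] ++ encodeNumber pe.2 ++ [Symbol.times]) ++ i)
      (hl pe List.mem_cons_self).ne_zero pe.2).trans
      (ih (fun q hq => hl q (List.mem_cons_of_mem _ hq)) _)
    rw [List.flatMap_cons, List.length_append, List.append_assoc]
    convert h using 2
    all_goals simp [wordsOf, joinWords]

theorem reach_input (L : List FactoredNat) (a : List Symbol) :
    Reach ((encodeInput L).length + 1) (config .start f (encodeInput L) a b k c m n o)
      (config .take f [] (joinWords (wordsOf (primesOf L)) ++ a) b k c m n o) := by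
  induction L generalizing a with
  | nil => exact .single step_start_nil
  | cons x L ih =>
    have h := ((reach_factors (f := f) (b := b) (k := k) (c := c) (m := m) (n := n) (o := o)
      (i := .comma :: encodeInput L) x.factors x.prime a).trans
      (Reach.single step_start_comma)).trans (ih _)
    have h1 : encodeInput (x :: L) = (x.factors.flatMap fun pe =>
        encodeNumber pe.1 ++ [Symbol.pow] ++ encodeNumber pe.2 ++ [Symbol.times]) ++
        .comma :: encodeInput L := by
      simp [encodeInput, encodeFactored]
    have h2 : joinWords (wordsOf (primesOf (x :: L))) ++ a = joinWords (wordsOf (primesOf L)) ++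
        (joinWords (wordsOf (x.factors.map Prod.fst)) ++ a) := by
      simp [wordsOf, primesOf, joinWords_append]
    rw [h1, h2]
    exact h.mono (by simp only [List.length_append, List.length_cons]; omega)

theorem reach_take (w : List Symbol) (hw : .pow ∉ w) (c : List Symbol) :
    Reach (w.length + 1) (config .take f i (w ++ .pow :: a) b k c m n o)
      (config .restore f i a b k (w.reverse ++ c) m n o) := by
  induction w generalizing c with
  | nil => exact .single step_take_pow
  | cons x w ih =>
    rw [List.mem_cons, not_or] at hw
    rw [List.reverse_cons, List.append_assoc]
    exact ((Reach.single (step_take_cons (Ne.symm hw.1))).trans (ih hw.2 (x :: c))).mono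
      (by rw [List.length_cons]; omega)

theorem reach_restore (c k : List Symbol) :
    Reach c.length (config .restore f i a b k c m n o)
      (config .restore f i a b (c.reverse ++ k) [] m n o) := by
  induction c generalizing k with
  | nil => exact .refl _
  | cons x c ih =>
    rw [List.reverse_cons, List.append_assoc]
    exact ((Reach.single step_restore_cons).trans (ih (x :: k))).mono
      (by rw [List.length_cons]; omega)

/-- The key is split between `checked`, reversed, and `key`; the invariant `c'.reverse ++ k'` lets
`restore` rebuild it whether or not the comparison succeeded. -/
theorem exists_reach_compare (u : List Symbol) (hu : .pow ∉ u) (f : Bool) (b k c : List Symbol) :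
    ∃ k' c', c'.reverse ++ k' = c.reverse ++ k ∧
      Reach (u.length + 1) (config .scan f i (u ++ .pow :: a) b k c m n o)
        (config .restore (f && decide (u = k)) i a (.pow :: u.reverse ++ b) k' c' m n o) := by
  induction u generalizing f b k c with
  | nil =>
    cases k with
    | nil => exact ⟨[], c, rfl, by simpa using Reach.single step_scan_pow_nil⟩
    | cons y k => exact ⟨k, y :: c, by simp, by simpa using Reach.single step_scan_pow_cons⟩
  | cons x u ih =>
    rw [List.mem_cons, not_or] at hu
    cases k with
    | nil =>
      obtain ⟨k', c', h1, h2⟩ := ih hu.2 false (x :: b) [] c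
      refine ⟨k', c', h1, ?_⟩
      have h3 := ((Reach.single (step_scan_cons_nil (f := f) (Ne.symm hu.1))).trans h2).mono
        (show 1 + (u.length + 1) ≤ (x :: u).length + 1 by rw [List.length_cons]; omega)
      simpa using h3
    | cons y k =>
      obtain ⟨k', c', h1, h2⟩ := ih hu.2 (f && decide (x = y)) (x :: b) k (y :: c)
      refine ⟨k', c', by simpa using h1, ?_⟩
      have h3 := ((Reach.single (step_scan_cons_cons (f := f) (Ne.symm hu.1))).trans h2).mono
        (show 1 + (u.length + 1) ≤ (x :: u).length + 1 by rw [List.length_cons]; omega)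
      simpa [Bool.and_assoc] using h3

theorem reach_scan_word (u : List Symbol) (hu : .pow ∉ u) (b k : List Symbol) (s t : ℕ) :
    Reach (u.length + k.length + 2)
      (config .scan true i (u ++ .pow :: a) b k [] (List.replicate s .one) (List.replicate t .one) o)
      (config .scan true i a (.pow :: u.reverse ++ b) k []
        (List.replicate (s - if u = k then 1 else 0) .one)
        (List.replicate (t + if u = k then 1 else 0) .one) o) := by
  obtain ⟨k', c', h1, h2⟩ := exists_reach_compare (i := i) (a := a) (m := List.replicate s .one)
    (n := List.replicate t .one) (o := o) u hu true b k []
  have h3 := h2.trans (reach_restore c' k')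
  have h4 : c'.length ≤ k.length := by
    have := congrArg List.length h1
    simp at this
    omega
  rw [h1] at h3
  split_ifs with h
  · simp only [h, decide_true, Bool.and_true, List.reverse_nil, List.nil_append] at h3 ⊢
    have h5 := h3.trans (.single step_restore_true)
    rw [List.tail_replicate, ← List.replicate_succ] at h5
    exact h5.mono (by omega)
  · simp only [h, decide_false, Bool.and_false, List.reverse_nil, List.nil_append] at h3 ⊢
    exact (h3.trans (.single step_restore_false)).mono (by omega)

theorem reach_scan (W : List (List Symbol)) (hW : ∀ w ∈ W, .pow ∉ w) (b k : List Symbol) (s t : ℕ) :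
    Reach ((joinWords W).length + W.length * (k.length + 1))
      (config .scan true i (joinWords W) b k [] (List.replicate s .one) (List.replicate t .one) o)
      (config .scan true i [] ((joinWords W).reverse ++ b) k []
        (List.replicate (s - W.count k) .one) (List.replicate (t + W.count k) .one) o) := by
  induction W generalizing b s t with
  | nil => simpa [joinWords] using Reach.refl _
  | cons u W ih =>
    have h := (reach_scan_word (i := i) (a := joinWords W) (o := o) u (hW u List.mem_cons_self)
      b k s t).trans (ih (fun w hw => hW w (List.mem_cons_of_mem _ hw)) _ _ _)
    have h1 : (u :: W).count k = W.count k + if u = k then 1 else 0 := by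
      rw [List.count_cons]; simp
    rw [joinWords_cons, h1, add_comm (W.count k), ← Nat.sub_sub, ← add_assoc]
    have h2 : (u ++ .pow :: joinWords W).reverse ++ b =
        (joinWords W).reverse ++ (.pow :: u.reverse ++ b) := by simp
    rw [h2]
    refine h.mono ?_
    simp only [List.length_append, List.length_cons]
    linarith

theorem reach_clear (k : List Symbol) :
    Reach (k.length + 1) (config .clear f i a b k c m n o)
      (config .unscan f i a b [] c m n o) := by
  induction k with
  | nil => exact .single step_clear_nil
  | cons x k ih =>
    exact ((Reach.single step_clear_cons).trans ih).mono (by rw [List.length_cons]; omega)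

theorem reach_unscan (b a : List Symbol) :
    Reach (b.length + 1) (config .unscan f i a b k c m n o)
      (config .merge f i (b.reverse ++ a) [] k c m n o) := by
  induction b generalizing a with
  | nil => exact .single step_unscan_nil
  | cons x b ih =>
    rw [List.reverse_cons, List.append_assoc]
    exact ((Reach.single step_unscan_cons).trans (ih (x :: a))).mono
      (by rw [List.length_cons]; omega)

theorem reach_merge (s t : ℕ) :
    Reach (t + 1)
      (config .merge f i a b k c (List.replicate s .one) (List.replicate t .one) o)
      (config .take f i a b k c (List.replicate (s + t) .one) [] o) := by
  induction t generalizing s with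
  | zero => exact .single step_merge_nil
  | succ t ih =>
    rw [add_comm t 1, ← add_assoc]
    rw [List.replicate_add 1 t]
    exact ((Reach.single step_merge_cons).trans (ih (s + 1))).mono (by omega)

theorem reach_round (w : List Symbol) (W : List (List Symbol)) (hW : ∀ v ∈ w :: W, .pow ∉ v)
    (s : ℕ) :
    Reach (10 * ((joinWords (w :: W)).length + 1) ^ 2)
      (config .take true i (joinWords (w :: W)) [] [] [] (List.replicate s .one) [] o)
      (config .take true i (joinWords W) [] [] []
        (List.replicate (max s (W.count w + 1)) .one) [] o) := by
  have hW' : ∀ v ∈ W, .pow ∉ v := fun v hv => hW v (List.mem_cons_of_mem _ hv)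
  have h1 := reach_take (f := true) (i := i) (a := joinWords W) (b := []) (k := [])
    (m := List.replicate s .one) (n := []) (o := o) w (hW w List.mem_cons_self) []
  have h2 := h1.trans (reach_restore _ _)
  simp only [List.append_nil, List.reverse_reverse] at h2
  have h3 := h2.trans (.single step_restore_true)
  rw [List.tail_replicate] at h3
  have h4 := h3.trans (reach_scan W hW' [] w (s - 1) 1)
  have h5 := ((h4.trans (.single step_scan_nil)).trans (reach_clear _)).trans (reach_unscan _ _)
  simp only [List.append_nil, List.reverse_reverse] at h5
  have h6 := h5.trans (reach_merge _ _)
  -- Moving `c` units out of `best` with truncation and then adding `c` back yields `max s c`. Here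
  -- `c` is `W.count w + 1`, the `1` being the key itself.
  have h7 : s - 1 - W.count w + (1 + W.count w) = max s (W.count w + 1) := by omega
  rw [h7] at h6
  rw [joinWords_cons]
  refine h6.mono ?_
  have h8 : W.count w ≤ W.length := List.count_le_length
  have h9 := length_le_length_joinWords W
  simp only [List.length_append, List.length_cons, List.length_reverse, List.length_tail]
  generalize (joinWords W).length = S at *
  generalize w.length = k at *
  have h10 : W.length * (k + 1) ≤ (S + k + 1) * (S + k + 1) :=
    Nat.mul_le_mul (by omega) (by omega)
  have h11 : 10 * (k + (S + 1) + 1) ^ 2 = 10 * ((S + k + 1) * (S + k + 1)) +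
    20 * (S + k + 1) + 10 := by ring
  omega

theorem reach_rounds (W : List (List Symbol)) (hW : ∀ v ∈ W, .pow ∉ v) (s B : ℕ)
    (hB : (joinWords W).length ≤ B) :
    Reach (W.length * (10 * (B + 1) ^ 2))
      (config .take true i (joinWords W) [] [] [] (List.replicate s .one) [] o)
      (config .take true i [] [] [] [] (List.replicate (maxCount s W) .one) [] o) := by
  induction W generalizing s with
  | nil => exact (Reach.refl _).mono (Nat.zero_le _)
  | cons w W ih =>
    have h := (reach_round (i := i) (o := o) w W hW s).trans
      (ih (fun v hv => hW v (List.mem_cons_of_mem _ hv)) _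
        (by rw [joinWords_cons, List.length_append, List.length_cons] at hB; omega))
    refine h.mono ?_
    rw [List.length_cons, add_mul, one_mul, add_comm]
    gcongr

/-! ### Conversion from unary to binary -/

/-- The binary expansion of the successor. -/
def increment : List Bool → List Bool
  | true :: l => false :: increment l
  | false :: l => true :: l
  | [] => [true]

theorem encodeNat_succ (r : ℕ) :
    Computability.encodeNat (r + 1) = increment (Computability.encodeNat r) := by
  have h (p : PosNum) : Computability.encodePosNum p.succ =
      increment (Computability.encodePosNum p) := by
    induction p with
    | one => rfl
    | bit0 p ih => rfl
    | bit1 p ih =>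
      rw [PosNum.succ, Computability.encodePosNum, ih]
      rfl
  rw [Computability.encodeNat, Computability.encodeNat, Nat.cast_succ, Num.add_one]
  cases (r : Num) with
  | zero => rfl
  | pos p => exact h p

theorem length_increment_le (l : List Bool) : (increment l).length ≤ l.length + 1 := by
  induction l with
  | nil => exact le_rfl
  | cons x l ih =>
    cases x
    · exact Nat.le_succ _
    · exact Nat.succ_le_succ ih

theorem length_encodeNat_le (r : ℕ) : (Computability.encodeNat r).length ≤ r := by
  induction r with
  | zero => exact le_rfl
  | succ r ih =>
    rw [encodeNat_succ]
    exact (length_increment_le _).trans (Nat.succ_le_succ ih)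

theorem reach_carry (s : ℕ) (o : List Bool) :
    Reach (s + 1) (config .carry f i a b k (List.replicate s .one) m n o)
      (config .count f i a b k [] m n (List.replicate s false ++ o)) := by
  induction s generalizing o with
  | zero => exact .single step_carry_nil
  | succ s ih =>
    rw [List.replicate_succ' (a := false), List.append_assoc]
    exact ((Reach.single step_carry_cons).trans (ih (false :: o))).mono (by omega)

/-- The `s` symbols on `checked` record the ones already passed by the carry; `carry` turns them
into zeros. Each digit is handled at most twice, hence the factor `2`. -/
theorem reach_increment (o : List Bool) (s : ℕ) :
    Reach (2 * o.length + s + 2) (config .increment f i a b k (List.replicate s .one) m n o)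
      (config .count f i a b k [] m n (List.replicate s false ++ increment o)) := by
  induction o generalizing s with
  | nil => exact ((Reach.single step_increment_nil).trans (reach_carry s _)).mono (by omega)
  | cons x o ih =>
    cases x
    · exact ((Reach.single step_increment_false).trans (reach_carry s _)).mono (by omega)
    · have h := (Reach.single step_increment_true).trans (ih (s + 1))
      rw [List.replicate_succ' (a := false), List.append_assoc] at h
      exact h.mono (by rw [List.length_cons]; omega)

theorem reach_count (s r : ℕ) :
    Reach (s * (2 * (r + s) + 3) + 1)
      (config .count f i a b k [] (List.replicate s .one) n (Computability.encodeNat r))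
      ⟨none, (none, none, true), contents i a b k [] [] n (Computability.encodeNat (r + s))⟩ := by
  induction s generalizing r with
  | zero => exact .mono (.single step_count_nil) (by omega)
  | succ s ih =>
    have h := ((Reach.single (step_count_cons (x := .one))).trans (reach_increment (f := f) (i := i) (a := a)
      (b := b) (k := k) (m := List.replicate s .one) (n := n) (Computability.encodeNat r) 0))
    rw [List.replicate_zero (a := false), List.nil_append, ← encodeNat_succ] at h
    have h1 := h.trans (ih (r + 1))
    rw [add_assoc r, add_comm 1 s] at h1
    refine h1.mono ?_
    have := length_encodeNat_le r
    rw [add_mul, one_mul]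
    omega

end reach

/-! ### Total running time and conclusion -/

theorem pow_notMem_wordsOf {ps : List ℕ} {w : List Symbol} (h : w ∈ wordsOf ps) : .pow ∉ w := by
  obtain ⟨p, _, rfl⟩ := List.mem_map.1 (List.mem_reverse.1 h)
  intro h
  simpa using mem_encodeNumber (List.mem_reverse.1 h)

theorem length_joinWords_wordsOf_append (ps qs : List ℕ) :
    (joinWords (wordsOf (ps ++ qs))).length =
      (joinWords (wordsOf ps)).length + (joinWords (wordsOf qs)).length := by
  simp [wordsOf, joinWords, add_comm]

theorem length_joinWords_le (L : List FactoredNat) :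
    (joinWords (wordsOf (primesOf L))).length ≤ (encodeInput L).length := by
  have h (l : List (ℕ × ℕ)) : (joinWords (wordsOf (l.map Prod.fst))).length ≤
      (l.flatMap fun pe =>
        encodeNumber pe.1 ++ [Symbol.pow] ++ encodeNumber pe.2 ++ [Symbol.times]).length := by
    induction l with
    | nil => exact le_rfl
    | cons pe l ih =>
      rw [List.map_cons, ← List.singleton_append, length_joinWords_wordsOf_append,
        List.flatMap_cons, List.length_append]
      refine add_le_add ?_ ih
      simp [wordsOf, joinWords]
  induction L with
  | nil => exact le_rfl
  | cons x L ih =>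
    rw [primesOf, List.flatMap_cons, length_joinWords_wordsOf_append, encodeInput,
      List.flatMap_cons, List.length_append]
    refine add_le_add ((h x.factors).trans ?_) ih
    rw [encodeFactored, List.length_append]
    exact Nat.le_add_right _ _

/-- With input length `B` there are at most `B` rounds of at most `10 * (B + 1) ^ 2` steps; reading
is linear and the conversion to binary quadratic in `B`. -/
theorem reach_halt (L : List FactoredNat) :
    Reach (20 * ((encodeInput L).length + 1) ^ 3)
      (config .start true (encodeInput L) [] [] [] [] [] [] [])
      ⟨none, (none, none, true),
        contents [] [] [] [] [] [] [] (Computability.encodeNat (maxSizeFactored L))⟩ := by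
  set W := wordsOf (primesOf L) with hWdef
  have h1 := reach_input (f := true) (b := []) (k := []) (c := []) (m := []) (n := []) (o := []) L []
  rw [List.append_nil, ← hWdef] at h1
  have hB := length_joinWords_le L
  have hl := length_le_length_joinWords W
  have h2 := ((h1.trans (reach_rounds W (fun _ => pow_notMem_wordsOf) 0 _ hB)).trans
    (.single step_take_nil)).trans (reach_count _ 0)
  have hm := maxCount_zero_le_length W
  rw [zero_add, maxCount_wordsOf] at h2
  rw [maxCount_wordsOf] at hm
  refine h2.mono ?_
  rw [← hWdef] at hB
  generalize (encodeInput L).length = B at *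
  generalize maxSizeFactored L = r at *
  have h3 : W.length * (10 * (B + 1) ^ 2) ≤ B * (10 * (B + 1) ^ 2) :=
    Nat.mul_le_mul_right _ (hl.trans hB)
  have h4 : r * (2 * r + 3) ≤ B * (2 * B + 3) := Nat.mul_le_mul (by omega) (by omega)
  nlinarith [sq_nonneg B, pow_pos (Nat.succ_pos B) 3]

theorem initList_machine (l : List Symbol) :
    initList machine l = config .start true l [] [] [] [] [] [] [] := by
  unfold initList config
  congr 1
  funext s
  cases s <;> rfl

theorem haltList_machine (l : List Bool) :
    haltList machine l = ⟨none, (none, none, true), contents [] [] [] [] [] [] [] l⟩ := by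
  unfold haltList
  congr 1
  funext s
  cases s <;> rfl

end Machine

theorem nonempty_computableInPolyTime_maxSizeFactored :
    Nonempty (Turing.TM2ComputableInPolyTime encodeInput Computability.encodeNat
      maxSizeFactored) := by
  refine ⟨⟨⟨Machine.machine, Equiv.refl _, Equiv.refl _⟩,
    Polynomial.C 20 * (Polynomial.X + 1) ^ 3, fun L => Classical.choice ?_⟩⟩
  obtain ⟨s, hs, h⟩ := Machine.reach_halt L
  rw [← Machine.initList_machine] at h
  have h' := h.trans (congrArg some (Machine.haltList_machine _).symm)
  rw [← List.map_id (encodeInput L), ← List.map_id (Computability.encodeNat _)] at h'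
  exact ⟨⟨⟨s, h'⟩, by simpa using hs⟩⟩

end Denumerant

theorem theorem2 :
    (∀ (N : ℕ) (a : Fin (N + 1) → ℕ), (∀ i, 0 < a i) →
      (∃! E : Fin (N + 1) → ℕ → ℚ, Denumerant.IsCoefficients a E) ∧
      ∀ E : Fin (N + 1) → ℕ → ℚ, Denumerant.IsCoefficients a E →
        -- the coefficients of degree `k ≥ ℓ` are constant
        (∀ k : Fin (N + 1), Denumerant.maxSize a ≤ (k : ℕ) → ∃ c : ℚ, ∀ t, E k t = c) ∧
        -- the coefficient of degree `k = ℓ - 1`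
        (∀ k : Fin (N + 1), (k : ℕ) + 1 = Denumerant.maxSize a →
          (¬ ∃ c : ℚ, ∀ t, E k t = c) ∧
          (Denumerant.gcdSet k a : Set ℕ).Pairwise Nat.Coprime ∧
          IsLeast {q : ℕ | 0 < q ∧ Function.Periodic (E k) q}
            (∏ f ∈ Denumerant.gcdSet k a, f))) ∧
    Nonempty (Turing.TM2ComputableInPolyTime Denumerant.encodeInput Computability.encodeNat
      Denumerant.maxSizeFactored) := by
  exact ⟨fun _ _ ha => Denumerant.coefficients_spec ha,
    Denumerant.nonempty_computableInPolyTime_maxSizeFactored⟩
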